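/- Let $\mathbb{D}$ be the open unit disc, $\mathbb{T}$ the unit circle and $m$ the normalized Lebesgue measure on $\mathbb{T}$. Let $\Theta$ be an inner function, that is, a bounded holomorphic function on $\mathbb{D}$ whose radial limits exist and have modulus one $m$-almost everywhere on $\mathbb{T}$. Let $H^2$ be the Hardy space, regarded through boundary values as the subspace of $L^2(\mathbb{T},m)$ of functions whose Fourier coefficients of negative index vanish, and let $(\Theta H^2)^\perp = H^2\ominus \Theta H^2$ be the model space of $\Theta$. The boundary spectrum of $\Theta$ is $$\sigma(\Theta)=\Big\{\xi\in\mathbb{T} : \liminf_{z\to\xi,\ z\in\mathbb{D}}|\Theta(z)|=0\Big\}.$$ A Lebesgue measurable set $\Sigma\subset\mathbb{T}$ with $m(\Sigma)<1$ is called a dominating set for $(\Theta H^2)^\perp$ if there is a constant $C>0$ such that $$\int_{\mathbb{T}}|f|^2\,dm\le C\int_\Sigma|f|^2\,dm\qquad\text{for all } f\in(\Theta H^2)^\perp.$$ For $\zeta\in\mathbb{T}$ put $d(\zeta,\Sigma)=\inf\{|\zeta-a| : a\in\Sigma\}$ (with $\inf\varnothing=\infty$). Then: 1. If $\Sigma$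 is a dominating set for $(\Theta H^2)^\perp$, then $d(\zeta,\Sigma)=0$ for every $\zeta\in\sigma(\Theta)$. 2. If $\sigma(\Theta)=\mathbb{T}$, then every dominating set for $(\Theta H^2)^\perp$ is dense in $\mathbb{T}$. 3. The space $(\Theta H^2)^\perp$ has a dominating set that is closed in $\mathbb{T}$ if and only if $\sigma(\Theta)\neq\mathbb{T}$. -/

import Mathlib

open Filter Topology MeasureTheory

namespace ModelSpace

/-- `m`, the normalized Lebesgue (Haar) measure of the unit circle, transported to `ℝ / ℤ` by the
parametrization `x ↦ e^{2πix}` of the circle, which is `AddCircle.toCircle`. Functions on the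
circle are written as functions of the parameter `x`; subsets of the circle are sets in `Circle`. -/
noncomputable abbrev m : Measure UnitAddCircle := AddCircle.haarAddCircle

/-- The point `e^{2πix}` of the complex plane. -/
noncomputable def point (x : UnitAddCircle) : ℂ := (AddCircle.toCircle x : ℂ)

/-- The set of parameters of the points of `S`. -/
def param (S : Set Circle) : Set UnitAddCircle := AddCircle.toCircle ⁻¹' S

/-- `Θ`, restricted to the open unit disc, is an inner function: it is holomorphic and bounded,
and its radial limits exist and have modulus one almost everywhere on the circle. -/
structure IsInner (Θ : ℂ → ℂ) : Prop where
  holomorphic : DifferentiableOn ℂ Θ (Metric.ball 0 1)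
  bounded : ∃ M : ℝ, ∀ z ∈ Metric.ball (0 : ℂ) 1, ‖Θ z‖ ≤ M
  radial : ∀ᵐ x ∂m, ∃ w : ℂ, ‖w‖ = 1 ∧
    Tendsto (fun r : ℝ => Θ ((r : ℂ) * point x)) (𝓝[<] 1) (𝓝 w)

/-- The radial limit of `Θ` at `e^{2πix}` (for an inner function it exists almost everywhere). -/
noncomputable def boundaryValue (Θ : ℂ → ℂ) (x : UnitAddCircle) : ℂ :=
  limUnder (𝓝[<] (1 : ℝ)) (fun r : ℝ => Θ ((r : ℂ) * point x))

/-- The Hardy space `H²`, as the space of its boundary functions: the functions in `L²(m)` whose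
Fourier coefficients of negative index vanish. -/
noncomputable def H2 : Submodule ℂ (Lp ℂ 2 m) where
  carrier := {f | ∀ n : ℤ, n < 0 → fourierCoeff f n = 0}
  zero_mem' := fun n _ => by
    rw [← fourierBasis_repr, map_zero]
    rfl
  add_mem' := fun {f g} hf hg n hn => by
    rw [← fourierBasis_repr, map_add, lp.coeFn_add, Pi.add_apply, fourierBasis_repr,
      fourierBasis_repr, hf n hn, hg n hn, add_zero]
  smul_mem' := fun c f hf n hn => by
    rw [← fourierBasis_repr, map_smul, lp.coeFn_smul, Pi.smul_apply, fourierBasis_repr,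
      hf n hn, smul_zero]

/-- `Θ H²`, the products of the boundary function of `Θ` with the functions in `H²`. -/
noncomputable def innerMulH2 (Θ : ℂ → ℂ) : Submodule ℂ (Lp ℂ 2 m) where
  carrier := {g | ∃ h ∈ H2, g =ᵐ[m] fun x => boundaryValue Θ x * h x}
  zero_mem' := ⟨0, H2.zero_mem, by
    filter_upwards [Lp.coeFn_zero ℂ 2 m] with x hx
    rw [hx, Pi.zero_apply, mul_zero]⟩
  add_mem' := by
    rintro f g ⟨h, hh, hf⟩ ⟨k, hk, hg⟩
    refine ⟨h + k, H2.add_mem hh hk, ?_⟩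
    filter_upwards [Lp.coeFn_add f g, Lp.coeFn_add h k, hf, hg] with x h1 h2 h3 h4
    rw [h1, h2, Pi.add_apply, Pi.add_apply, h3, h4, mul_add]
  smul_mem' := by
    rintro c f ⟨h, hh, hf⟩
    refine ⟨c • h, H2.smul_mem c hh, ?_⟩
    filter_upwards [Lp.coeFn_smul c f, Lp.coeFn_smul c h, hf] with x h1 h2 h3
    rw [h1, h2, Pi.smul_apply, Pi.smul_apply, h3, smul_eq_mul, smul_eq_mul, mul_left_comm]

/-- The model space `(Θ H²)^⊥ = H² ⊖ Θ H²`, the orthogonal complement being taken in `H²`. -/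
noncomputable def modelSpace (Θ : ℂ → ℂ) : Submodule ℂ (Lp ℂ 2 m) :=
  H2 ⊓ (innerMulH2 Θ)ᗮ

/-- The boundary spectrum `σ(Θ)`: the points `ξ` of the circle at which the lower limit of
`|Θ(z)|`, as `z` tends to `ξ` in the open unit disc, is zero. -/
def boundarySpectrum (Θ : ℂ → ℂ) : Set Circle :=
  {ξ | liminf (fun z : ℂ => ‖Θ z‖) (𝓝[Metric.ball (0 : ℂ) 1] (ξ : ℂ)) = 0}

/-- `S` is a dominating set for `(Θ H²)^⊥`: it is Lebesgue measurable, `m(S) < 1`, and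
`‖f‖² ≤ C ∫_S |f|² dm` for all `f` in the model space, with a constant `C` independent of `f`. -/
structure IsDominating (Θ : ℂ → ℂ) (S : Set Circle) : Prop where
  measurable : NullMeasurableSet (param S) m
  measure_lt_one : m (param S) < 1
  dominates : ∃ C : ℝ, 0 < C ∧
    ∀ f ∈ modelSpace Θ, ‖f‖ ^ 2 ≤ C * ∫ x in param S, ‖f x‖ ^ 2 ∂m

end ModelSpace

namespace ModelSpace

open scoped ComplexConjugate

/-! Everything rests on the reproducing kernel `k_l = (1 - conj Θ(l) Θ) / (1 - conj l z)` of the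
model space, with `‖k_l‖² = (1 - |Θ(l)|²) / (1 - |l|²)` (`IsInner.kernel_mem`,
`IsInner.norm_kernel_sq`).

If `ζ ∈ σ(Θ)` had positive distance `d` from a dominating set, then kernels at points `l → ζ` with
`|Θ(l)| < 1/2` would have norms tending to infinity while staying below `4/d` on the set, a
contradiction (`IsInner.infEDist_eq_zero`). Density for `σ(Θ) = 𝕋` follows, and a closed dense set
is the whole circle, which has measure one.

Conversely, let `ξ ∉ σ(Θ)`. It suffices to find an open arc carrying at most half of `‖f‖²` for
every `f` in the model space (`IsInner.exists_arc`): its complement is closed and dominating. The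
kernel gives `|f(l)|² ≤ ‖f‖² (1 - |Θ(l)|²) / (1 - |l|²)`, so this quotient must be controlled on
circles near `𝕋`. Near `ξ`, `log |Θ|` is harmonic and bounded, with radial limits zero almost
everywhere. A weighted mean of it at height `y` has bounded second derivative in `y` and tends to
zero, hence is `O(y)` (`exists_abs_integral_log_norm_le`). As `1 - t² ≤ -2 log t`, the quotient has
bounded integrals over an arc, uniformly in `y`. By pigeonhole some subarc has small integrals for
arbitrarily small `y`, and `L²` convergence of Abel means carries the bound to `f` itself. No
analytic continuation of `Θ` across the arc is needed. -/

lemma continuous_point : Continuous point :=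
  continuous_subtype_val.comp AddCircle.continuous_toCircle

lemma norm_point (x : UnitAddCircle) : ‖point x‖ = 1 := Circle.norm_coe _

lemma fourier_eq_point (n : ℤ) (x : UnitAddCircle) : fourier n x = point x ^ n := by
  rw [fourier_apply, AddCircle.toCircle_zsmul, Circle.coe_zpow, point]

lemma point_coe (x : ℝ) : point x = Complex.exp (2 * Real.pi * x * Complex.I) := by
  rw [point, AddCircle.toCircle_apply_mk, Circle.coe_exp]
  push_cast
  ring_nf

lemma integral_m_eq {E : Type*} [NormedAddCommGroup E] [NormedSpace ℝ E] (F : UnitAddCircle → E)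
    (t : ℝ) : ∫ x, F x ∂m = ∫ x in t..t + 1, F x := by
  rw [AddCircle.integral_haarAddCircle, inv_one, one_smul, UnitAddCircle.intervalIntegral_preimage]

lemma integral_comp_point (F : ℂ → ℂ) : ∫ x, F (point x) ∂m = Real.circleAverage F 0 1 := by
  have h : ∀ x : ℝ, F (point x) = F (circleMap 0 1 (2 * Real.pi * x)) := fun x => by
    rw [point_coe, circleMap]
    push_cast
    ring_nf
  rw [integral_m_eq _ 0, zero_add, Real.circleAverage]
  simp_rw [h]
  rw [intervalIntegral.integral_comp_mul_left (fun t => F (circleMap 0 1 t)) (by positivity)]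
  simp

/-! ### The Szegő kernel and Cauchy's formula. -/

/-- The Szegő kernel at `l`. -/
noncomputable def szego (l : ℂ) (x : UnitAddCircle) : ℂ := (1 - conj l * point x)⁻¹

lemma one_sub_mul_ne_zero {l z : ℂ} (hl : ‖l‖ < 1) (hz : ‖z‖ ≤ 1) : 1 - conj l * z ≠ 0 := by
  intro h
  have h1 : ‖conj l * z‖ = 1 := by rw [← sub_eq_zero.1 h, norm_one]
  rw [norm_mul, RCLike.norm_conj] at h1
  nlinarith [norm_nonneg l, norm_nonneg z]

lemma continuous_szego {l : ℂ} (hl : ‖l‖ < 1) : Continuous (szego l) :=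
  (continuous_const.sub (continuous_const.mul continuous_point)).inv₀
    fun x => one_sub_mul_ne_zero hl (norm_point x).le

/-- Since `conj z = 1/z` on the circle, the conjugate Szegő kernel is the Cauchy kernel for
normalized arc length. -/
lemma conj_szego {l : ℂ} (x : UnitAddCircle) :
    conj (szego l x) = point x / (point x - l) := by
  have h : conj (point x) = (point x)⁻¹ := by
    rw [Complex.inv_def, Complex.normSq_eq_norm_sq, norm_point]; simp
  have h0 : point x ≠ 0 := fun h => by simpa [h] using norm_point x
  rw [szego, map_inv₀, map_sub, map_one, map_mul, Complex.conj_conj, h, ← inv_div]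
  congr 1
  field_simp

lemma norm_one_sub_mul_point (l : ℂ) (x : UnitAddCircle) :
    ‖1 - conj l * point x‖ = ‖point x - l‖ := by
  have h := congrArg norm (conj_szego (l := l) x)
  rw [RCLike.norm_conj, szego, norm_inv, norm_div, norm_point, one_div] at h
  exact inv_injective h

/-- Cauchy's formula in terms of the Szegő kernel. -/
lemma integral_conj_szego_mul {G : ℂ → ℂ} (hG : DiffContOnCl ℂ G (Metric.ball 0 1)) {l : ℂ}
    (hl : ‖l‖ < 1) : ∫ x, conj (szego l x) * G (point x) ∂m = G l := by
  have h := DiffContOnCl.circleAverage_smul_div (c := 0) (R := 1) (w := l) (f := G)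
    (by simpa using hG) (by simpa using hl)
  rw [← h, ← integral_comp_point]
  simp [conj_szego, smul_eq_mul]

lemma diffContOnCl_one_sub_mul_inv {l : ℂ} (hl : ‖l‖ < 1) :
    DiffContOnCl ℂ (fun z => (1 - conj l * z)⁻¹) (Metric.ball 0 1) := by
  refine DifferentiableOn.diffContOnCl fun z hz => ?_
  rw [closure_ball _ one_ne_zero, mem_closedBall_zero_iff] at hz
  have h : DifferentiableAt ℂ (fun z => 1 - conj l * z) z := by fun_prop
  exact (h.inv (one_sub_mul_ne_zero hl hz)).differentiableWithinAt

lemma one_sub_conj_mul_self (l : ℂ) : 1 - conj l * l = ((1 - ‖l‖ ^ 2 : ℝ) : ℂ) := by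
  rw [mul_comm, Complex.mul_conj, Complex.normSq_eq_norm_sq]
  push_cast
  ring

lemma integral_conj_szego_mul_szego {l : ℂ} (hl : ‖l‖ < 1) :
    ∫ x, conj (szego l x) * szego l x ∂m = ((1 - ‖l‖ ^ 2 : ℝ) : ℂ)⁻¹ := by
  rw [← one_sub_conj_mul_self]
  exact integral_conj_szego_mul (diffContOnCl_one_sub_mul_inv hl) hl

/-! ### Boundary values of an inner function. -/

section Inner

variable {Θ : ℂ → ℂ}

lemma IsInner.tendsto_boundaryValue (hΘ : IsInner Θ) :
    ∀ᵐ x ∂m, ‖boundaryValue Θ x‖ = 1 ∧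
      Tendsto (fun r : ℝ => Θ ((r : ℂ) * point x)) (𝓝[<] 1) (𝓝 (boundaryValue Θ x)) := by
  filter_upwards [hΘ.radial] with x ⟨w, hw, h⟩
  rw [boundaryValue, h.limUnder_eq]
  exact ⟨hw, h⟩

lemma mul_point_mem_ball {r : ℝ} (h0 : 0 ≤ r) (h1 : r < 1) {z : ℂ} (hz : ‖z‖ ≤ 1) :
    (r : ℂ) * z ∈ Metric.ball (0 : ℂ) 1 := by
  rw [mem_ball_zero_iff, norm_mul, Complex.norm_real, Real.norm_of_nonneg h0]
  nlinarith [norm_nonneg z]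

lemma IsInner.continuous_dilate (hΘ : IsInner Θ) {r : ℝ} (h0 : 0 ≤ r) (h1 : r < 1) :
    Continuous fun x => Θ ((r : ℂ) * point x) :=
  hΘ.holomorphic.continuousOn.comp_continuous (continuous_const.mul continuous_point)
    fun x => mul_point_mem_ball h0 h1 (norm_point x).le

lemma IsInner.diffContOnCl_dilate (hΘ : IsInner Θ) {r : ℝ} (h0 : 0 ≤ r) (h1 : r < 1) :
    DiffContOnCl ℂ (fun z => Θ ((r : ℂ) * z)) (Metric.ball 0 1) := by
  refine DifferentiableOn.diffContOnCl ?_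
  refine hΘ.holomorphic.comp (differentiableOn_id.const_mul _) fun z hz => ?_
  rw [closure_ball _ one_ne_zero, mem_closedBall_zero_iff] at hz
  exact mul_point_mem_ball h0 h1 hz

lemma IsInner.aestronglyMeasurable (hΘ : IsInner Θ) :
    AEStronglyMeasurable (boundaryValue Θ) m := by
  obtain ⟨u, -, hu1, hu⟩ := exists_seq_strictMono_tendsto' (zero_lt_one' ℝ)
  refine aestronglyMeasurable_of_tendsto_ae atTop (f := fun n x => Θ ((u n : ℂ) * point x))
    (fun n => (hΘ.continuous_dilate (hu1 n).1.le (hu1 n).2).aestronglyMeasurable) ?_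
  filter_upwards [hΘ.tendsto_boundaryValue] with x hx
  exact hx.2.comp (tendsto_nhdsWithin_iff.2 ⟨hu, .of_forall fun n => (hu1 n).2⟩)

/-- Cauchy's formula for the boundary function of an inner function. -/
lemma IsInner.integral_conj_szego_mul (hΘ : IsInner Θ) {G : ℂ → ℂ}
    (hG : DiffContOnCl ℂ G (Metric.ball 0 1)) {l : ℂ} (hl : ‖l‖ < 1) :
    ∫ x, conj (szego l x) * (boundaryValue Θ x * G (point x)) ∂m = Θ l * G l := by
  obtain ⟨u, -, hu1, hu⟩ := exists_seq_strictMono_tendsto' (zero_lt_one' ℝ)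
  obtain ⟨M, hM⟩ := hΘ.bounded
  have hGc : Continuous fun x => G (point x) :=
    hG.continuousOn_ball.comp_continuous continuous_point fun x => by simp [norm_point]
  have hs : Continuous fun x => conj (szego l x) :=
    Complex.continuous_conj.comp (continuous_szego hl)
  -- Cauchy's formula holds for the dilates `Θ(u n · z)`, which are holomorphic across the circle;
  -- boundedness of `Θ` allows dominated convergence as `u n → 1`.
  have h1 : Tendsto (fun n => ∫ x, conj (szego l x) * (Θ ((u n : ℂ) * point x) * G (point x)) ∂m)
      atTop (𝓝 (∫ x, conj (szego l x) * (boundaryValue Θ x * G (point x)) ∂m)) := by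
    refine tendsto_integral_of_dominated_convergence
      (fun x => ‖conj (szego l x)‖ * (M * ‖G (point x)‖)) (fun n => ?_) ?_ (fun n => ?_) ?_
    · exact (hs.mul ((hΘ.continuous_dilate (hu1 n).1.le (hu1 n).2).mul hGc)).aestronglyMeasurable
    · exact (hs.norm.mul (continuous_const.mul hGc.norm)).integrable_of_hasCompactSupport
        (HasCompactSupport.of_compactSpace _)
    · refine .of_forall fun x => ?_
      rw [norm_mul, norm_mul]
      gcongr
      exact hM _ (mul_point_mem_ball (hu1 n).1.le (hu1 n).2 (norm_point x).le)
    · filter_upwards [hΘ.tendsto_boundaryValue] with x hx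
      exact ((hx.2.comp (tendsto_nhdsWithin_iff.2
        ⟨hu, .of_forall fun n => (hu1 n).2⟩)).mul_const _).const_mul _
  refine tendsto_nhds_unique h1 ?_
  have h2 : ∀ n, ∫ x, conj (szego l x) * (Θ ((u n : ℂ) * point x) * G (point x)) ∂m
      = Θ (u n * l) * G l := fun n =>
    ModelSpace.integral_conj_szego_mul ((hΘ.diffContOnCl_dilate (hu1 n).1.le (hu1 n).2).smul hG) hl
  simp_rw [h2]
  have hc : ContinuousAt Θ l :=
    (hΘ.holomorphic.differentiableAt (Metric.isOpen_ball.mem_nhds (by simpa using hl))).continuousAt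
  have h3 : Tendsto (fun n => (u n : ℂ) * l) atTop (𝓝 l) := by
    simpa using ((Complex.continuous_ofReal.tendsto 1).comp hu).mul_const l
  exact (hc.tendsto.comp h3).mul_const _

end Inner

-- Fourier coefficients and Szegő kernels in `L²`.

local notation "⟪" f ", " g "⟫" => inner ℂ f g

lemma inner_eq_tsum_fourierCoeff (f g : Lp ℂ 2 m) :
    ⟪f, g⟫ = ∑' n : ℤ, conj (fourierCoeff f n) * fourierCoeff g n := by
  rw [← fourierBasis.repr.inner_map_map, lp.inner_eq_tsum]
  simp_rw [fourierBasis_repr, RCLike.inner_apply']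

lemma norm_sq_eq_tsum (f : Lp ℂ 2 m) : ‖f‖ ^ 2 = ∑' n : ℤ, ‖fourierCoeff f n‖ ^ 2 := by
  have h := lp.norm_rpow_eq_tsum (by simp) (fourierBasis.repr f)
  simp_rw [fourierBasis_repr] at h
  rw [fourierBasis.repr.norm_map] at h
  exact_mod_cast h

lemma norm_sq_eq_integral (f : Lp ℂ 2 m) : ‖f‖ ^ 2 = ∫ x, ‖f x‖ ^ 2 ∂m := by
  rw [norm_sq_eq_tsum, tsum_sq_fourierCoeff]

lemma integrable_norm_sq (f : Lp ℂ 2 m) : Integrable (fun x => ‖f x‖ ^ 2) m :=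
  (memLp_two_iff_integrable_sq_norm (Lp.memLp f).1).1 (Lp.memLp f)

lemma memLp_szego {l : ℂ} (hl : ‖l‖ < 1) : MemLp (szego l) 2 m :=
  (continuous_szego hl).memLp_of_hasCompactSupport (HasCompactSupport.of_compactSpace _)

/-- The Szegő kernel at `l` as an element of `L²`. -/
noncomputable def szegoLp {l : ℂ} (hl : ‖l‖ < 1) : Lp ℂ 2 m := (memLp_szego hl).toLp

lemma coeFn_szegoLp {l : ℂ} (hl : ‖l‖ < 1) : szegoLp hl =ᵐ[m] szego l := MemLp.coeFn_toLp _

/-- The Szegő kernel at `0` is `1`, so the integral is the value of `z ^ k * G z` at the origin. -/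
lemma integral_point_pow_mul {G : ℂ → ℂ} (hG : DiffContOnCl ℂ G (Metric.ball 0 1)) {k : ℕ}
    (hk : k ≠ 0) : ∫ x, point x ^ k * G (point x) ∂m = 0 := by
  have h := integral_conj_szego_mul (l := 0) (G := fun z => z ^ k * G z)
    ((differentiable_id.pow k).diffContOnCl.smul hG) (by simp)
  simpa [szego, hk] using h

lemma fourierCoeff_eq_of_neg (f : UnitAddCircle → ℂ) (k : ℕ) :
    fourierCoeff f (-k) = ∫ x, point x ^ k * f x ∂m := by
  simp only [fourierCoeff, neg_neg, fourier_eq_point, zpow_natCast, smul_eq_mul]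

lemma fourier_neg_natCast (k : ℕ) (x : UnitAddCircle) :
    fourier (-(k : ℤ)) x = conj (point x ^ k) := by
  rw [fourier_neg, fourier_eq_point, zpow_natCast]

lemma mem_H2_of_integral_eq_zero {f : Lp ℂ 2 m} {g : UnitAddCircle → ℂ} (hfg : f =ᵐ[m] g)
    (hg : ∀ k : ℕ, k ≠ 0 → ∫ x, point x ^ k * g x ∂m = 0) : f ∈ H2 := by
  intro n hn
  obtain ⟨k, rfl⟩ : ∃ k : ℕ, n = -k := ⟨n.natAbs, by omega⟩
  rw [fourierCoeff_congr_ae hfg, fourierCoeff_eq_of_neg, hg k (by omega)]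

lemma szegoLp_mem_H2 {l : ℂ} (hl : ‖l‖ < 1) : szegoLp hl ∈ H2 :=
  mem_H2_of_integral_eq_zero (coeFn_szegoLp hl) fun _ hk =>
    integral_point_pow_mul (diffContOnCl_one_sub_mul_inv hl) hk

lemma fourierCoeff_szego {l : ℂ} (hl : ‖l‖ < 1) (k : ℕ) :
    fourierCoeff (szego l) k = conj l ^ k := by
  have h := integral_conj_szego_mul (differentiable_id.pow k).diffContOnCl hl
  rw [fourierCoeff, ← map_pow]
  simp only [Pi.pow_apply, id] at h
  rw [← h, ← integral_conj]
  simp only [fourier_neg_natCast, smul_eq_mul, map_mul, Complex.conj_conj, mul_comm]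

/-- The value at `l` of the holomorphic function with boundary function `f`. -/
lemma inner_szegoLp {l : ℂ} (hl : ‖l‖ < 1) {f : Lp ℂ 2 m} (hf : f ∈ H2) :
    ⟪szegoLp hl, f⟫ = ∑' n : ℤ, l ^ n.natAbs * fourierCoeff f n := by
  rw [inner_eq_tsum_fourierCoeff]
  refine tsum_congr fun n => ?_
  rcases lt_or_ge n 0 with hn | hn
  · rw [hf n hn, mul_zero, mul_zero]
  · lift n to ℕ using hn
    rw [fourierCoeff_congr_ae (coeFn_szegoLp hl), fourierCoeff_szego hl]
    simp

/-! ### The reproducing kernel of the model space. -/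

section Inner

variable {Θ : ℂ → ℂ}

lemma IsInner.integral_point_pow_mul (hΘ : IsInner Θ) {G : ℂ → ℂ}
    (hG : DiffContOnCl ℂ G (Metric.ball 0 1)) {k : ℕ} (hk : k ≠ 0) :
    ∫ x, point x ^ k * (boundaryValue Θ x * G (point x)) ∂m = 0 := by
  have h := hΘ.integral_conj_szego_mul (l := 0) (G := fun z => z ^ k * G z)
    ((differentiable_id.pow k).diffContOnCl.smul hG) (by simp)
  simp only [szego, map_zero, zero_mul, sub_zero, inv_one, map_one, one_mul, ne_eq, hk,
    not_false_eq_true, zero_pow, mul_zero] at h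
  rw [← h]
  exact integral_congr_ae (.of_forall fun x => by ring)

lemma IsInner.memLp_boundaryValue_mul (hΘ : IsInner Θ) {f : UnitAddCircle → ℂ}
    (hf : MemLp f 2 m) : MemLp (fun x => boundaryValue Θ x * f x) 2 m :=
  hf.of_le (hΘ.aestronglyMeasurable.mul hf.1) (by
    filter_upwards [hΘ.tendsto_boundaryValue] with x hx
    rw [norm_mul, hx.1, one_mul])

/-- The product of the boundary function of `Θ` with the Szegő kernel at `l`. -/
noncomputable def IsInner.mulSzegoLp (hΘ : IsInner Θ) {l : ℂ} (hl : ‖l‖ < 1) : Lp ℂ 2 m :=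
  (hΘ.memLp_boundaryValue_mul (memLp_szego hl)).toLp

lemma IsInner.coeFn_mulSzegoLp (hΘ : IsInner Θ) {l : ℂ} (hl : ‖l‖ < 1) :
    hΘ.mulSzegoLp hl =ᵐ[m] fun x => boundaryValue Θ x * szego l x := MemLp.coeFn_toLp _

lemma IsInner.mulSzegoLp_mem_H2 (hΘ : IsInner Θ) {l : ℂ} (hl : ‖l‖ < 1) :
    hΘ.mulSzegoLp hl ∈ H2 :=
  mem_H2_of_integral_eq_zero (hΘ.coeFn_mulSzegoLp hl) fun _ hk =>
    hΘ.integral_point_pow_mul (diffContOnCl_one_sub_mul_inv hl) hk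

lemma IsInner.mulSzegoLp_mem (hΘ : IsInner Θ) {l : ℂ} (hl : ‖l‖ < 1) :
    hΘ.mulSzegoLp hl ∈ innerMulH2 Θ := by
  refine ⟨szegoLp hl, szegoLp_mem_H2 hl, ?_⟩
  filter_upwards [hΘ.coeFn_mulSzegoLp hl, coeFn_szegoLp hl] with x h1 h2
  rw [h1, h2]

/-- The reproducing kernel of the model space at `l`. -/
noncomputable def IsInner.kernel (hΘ : IsInner Θ) {l : ℂ} (hl : ‖l‖ < 1) : Lp ℂ 2 m :=
  szegoLp hl - conj (Θ l) • hΘ.mulSzegoLp hl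

lemma IsInner.coeFn_kernel (hΘ : IsInner Θ) {l : ℂ} (hl : ‖l‖ < 1) :
    hΘ.kernel hl =ᵐ[m] fun x => (1 - conj (Θ l) * boundaryValue Θ x) * szego l x := by
  filter_upwards [hΘ.coeFn_mulSzegoLp hl, coeFn_szegoLp hl,
    Lp.coeFn_sub (szegoLp hl) (conj (Θ l) • hΘ.mulSzegoLp hl),
    Lp.coeFn_smul (conj (Θ l)) (hΘ.mulSzegoLp hl)] with x h1 h2 h3 h4
  rw [IsInner.kernel, h3, Pi.sub_apply, h4, Pi.smul_apply, h1, h2, smul_eq_mul]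
  ring

lemma IsInner.inner_kernel (hΘ : IsInner Θ) {l : ℂ} (hl : ‖l‖ < 1) {f : Lp ℂ 2 m}
    (hf : f ∈ modelSpace Θ) : ⟪hΘ.kernel hl, f⟫ = ⟪szegoLp hl, f⟫ := by
  rw [IsInner.kernel, inner_sub_left, inner_smul_left,
    Submodule.inner_right_of_mem_orthogonal (hΘ.mulSzegoLp_mem hl) hf.2, mul_zero, sub_zero]

/-- `⟪s_l, Θ h⟫ = Θ(l) ⟪s_l, h⟫` for `h ∈ H²`, where `s_l` is the Szegő kernel. -/
lemma IsInner.inner_szegoLp_of_eq_mul (hΘ : IsInner Θ) {l : ℂ} (hl : ‖l‖ < 1) {g h : Lp ℂ 2 m}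
    (hh : h ∈ H2) (hg : g =ᵐ[m] fun x => boundaryValue Θ x * h x) :
    ⟪szegoLp hl, g⟫ = Θ l * ⟪szegoLp hl, h⟫ := by
  -- Move `Θ` across the inner product. For `n ≥ 0` the `n`-th coefficient of `conj Θ · s_l` is the
  -- conjugate of `Θ(l) l ^ n`, by Cauchy's formula for `Θ z ^ n`; negative indices do not matter
  -- because `h ∈ H²`.
  have hmem : MemLp (fun x => conj (boundaryValue Θ x) * szego l x) 2 m :=
    (memLp_szego hl).of_le ((Complex.continuous_conj.comp_aestronglyMeasurable
      hΘ.aestronglyMeasurable).mul (memLp_szego hl).1) (by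
        filter_upwards [hΘ.tendsto_boundaryValue] with x hx
        rw [norm_mul, RCLike.norm_conj, hx.1, one_mul])
  have h1 : ⟪szegoLp hl, g⟫ = ⟪hmem.toLp, h⟫ := by
    rw [L2.inner_def, L2.inner_def]
    refine integral_congr_ae ?_
    filter_upwards [hg, coeFn_szegoLp hl, hmem.coeFn_toLp] with x h1 h2 h3
    rw [h1, h2, h3, RCLike.inner_apply', RCLike.inner_apply', map_mul, Complex.conj_conj]
    ring
  rw [h1, inner_eq_tsum_fourierCoeff, inner_eq_tsum_fourierCoeff, ← tsum_mul_left]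
  refine tsum_congr fun n => ?_
  rcases lt_or_ge n 0 with hn | hn
  · rw [hh n hn, mul_zero, mul_zero, mul_zero]
  lift n to ℕ using hn
  rw [fourierCoeff_congr_ae (coeFn_szegoLp hl), fourierCoeff_szego hl,
    fourierCoeff_congr_ae hmem.coeFn_toLp, ← mul_assoc, fourierCoeff, ← integral_conj]
  congr 1
  rw [map_pow, Complex.conj_conj,
    ← hΘ.integral_conj_szego_mul (G := fun z => z ^ n) (differentiable_id.pow n).diffContOnCl hl]
  refine integral_congr_ae (.of_forall fun x => ?_)
  simp only [fourier_neg_natCast, smul_eq_mul, map_mul, Complex.conj_conj]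
  ring

/-- Because `|Θ| = 1` almost everywhere, `⟪Θ s_l, Θ h⟫ = ⟪s_l, h⟫`, which cancels against `⟪s_l, Θ
h⟫ = Θ(l) ⟪s_l, h⟫`. -/
lemma IsInner.kernel_mem (hΘ : IsInner Θ) {l : ℂ} (hl : ‖l‖ < 1) :
    hΘ.kernel hl ∈ modelSpace Θ := by
  refine ⟨H2.sub_mem (szegoLp_mem_H2 hl) (H2.smul_mem _ (hΘ.mulSzegoLp_mem_H2 hl)), ?_⟩
  rw [SetLike.mem_coe, Submodule.mem_orthogonal']
  rintro g ⟨h, hh, hg⟩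
  have h1 : ⟪hΘ.mulSzegoLp hl, g⟫ = ⟪szegoLp hl, h⟫ := by
    rw [L2.inner_def, L2.inner_def]
    refine integral_congr_ae ?_
    filter_upwards [hg, coeFn_szegoLp hl, hΘ.coeFn_mulSzegoLp hl,
      hΘ.tendsto_boundaryValue] with x h1 h2 h3 h4
    rw [h1, h2, h3, RCLike.inner_apply', RCLike.inner_apply', map_mul]
    have : conj (boundaryValue Θ x) * boundaryValue Θ x = 1 := by
      rw [mul_comm, Complex.mul_conj, Complex.normSq_eq_norm_sq, h4.1]; simp
    linear_combination conj (szego l x) * h x * this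
  rw [IsInner.kernel, inner_sub_left, inner_smul_left, h1, Complex.conj_conj,
    hΘ.inner_szegoLp_of_eq_mul hl hh hg, sub_self]

lemma norm_szegoLp_sq {l : ℂ} (hl : ‖l‖ < 1) : ⟪szegoLp hl, szegoLp hl⟫ =
    ((1 - ‖l‖ ^ 2 : ℝ) : ℂ)⁻¹ := by
  rw [← integral_conj_szego_mul_szego hl, L2.inner_def]
  refine integral_congr_ae ?_
  filter_upwards [coeFn_szegoLp hl] with x hx
  rw [hx, RCLike.inner_apply']

lemma IsInner.norm_kernel_sq (hΘ : IsInner Θ) {l : ℂ} (hl : ‖l‖ < 1) :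
    ‖hΘ.kernel hl‖ ^ 2 = (1 - ‖Θ l‖ ^ 2) / (1 - ‖l‖ ^ 2) := by
  have h1 : ⟪hΘ.kernel hl, hΘ.kernel hl⟫ = (((1 - ‖Θ l‖ ^ 2) / (1 - ‖l‖ ^ 2) : ℝ) : ℂ) := by
    rw [hΘ.inner_kernel hl (hΘ.kernel_mem hl), IsInner.kernel, inner_sub_right, inner_smul_right,
      hΘ.inner_szegoLp_of_eq_mul hl (szegoLp_mem_H2 hl) (g := hΘ.mulSzegoLp hl), norm_szegoLp_sq hl]
    · have := one_sub_conj_mul_self (Θ l)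
      push_cast at this ⊢
      rw [div_eq_mul_inv, ← this]
      ring
    · filter_upwards [hΘ.coeFn_mulSzegoLp hl, coeFn_szegoLp hl] with x h1 h2
      rw [h1, h2]
  rw [norm_sq_eq_re_inner (𝕜 := ℂ), h1]
  exact Complex.ofReal_re _

lemma one_sub_norm_sq_pos {l : ℂ} (hl : ‖l‖ < 1) : 0 < 1 - ‖l‖ ^ 2 := by
  nlinarith [norm_nonneg l]

/-- Nonnegativity of `‖k_l‖²` replaces the maximum principle. -/
lemma IsInner.norm_le_one (hΘ : IsInner Θ) {l : ℂ} (hl : ‖l‖ < 1) : ‖Θ l‖ ≤ 1 := by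
  have h := hΘ.norm_kernel_sq hl
  have h1 : 0 ≤ (1 - ‖Θ l‖ ^ 2) / (1 - ‖l‖ ^ 2) := h ▸ sq_nonneg _
  rw [le_div_iff₀ (one_sub_norm_sq_pos hl)] at h1
  nlinarith [norm_nonneg (Θ l)]

/-- Point evaluation in the model space. -/
lemma IsInner.norm_inner_szegoLp_sq_le (hΘ : IsInner Θ) {l : ℂ} (hl : ‖l‖ < 1) {f : Lp ℂ 2 m}
    (hf : f ∈ modelSpace Θ) :
    ‖⟪szegoLp hl, f⟫‖ ^ 2 ≤ ‖f‖ ^ 2 * ((1 - ‖Θ l‖ ^ 2) / (1 - ‖l‖ ^ 2)) := by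
  rw [← hΘ.inner_kernel hl hf, ← hΘ.norm_kernel_sq hl, mul_comm, ← mul_pow]
  gcongr
  exact norm_inner_le_norm _ _

end Inner

/-! ### Dominating sets accumulate at the boundary spectrum. -/

section Inner

variable {Θ : ℂ → ℂ}

instance neBot_nhdsWithin_ball (ξ : Circle) : (𝓝[Metric.ball (0 : ℂ) 1] (ξ : ℂ)).NeBot := by
  rw [← mem_closure_iff_nhdsWithin_neBot, closure_ball _ one_ne_zero,
    mem_closedBall_zero_iff]
  exact (Circle.norm_coe ξ).le

lemma isBoundedUnder_ge_norm (ξ : Circle) :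
    IsBoundedUnder (· ≥ ·) (𝓝[Metric.ball (0 : ℂ) 1] (ξ : ℂ)) fun z => ‖Θ z‖ :=
  ⟨0, eventually_map.2 (.of_forall fun _ => norm_nonneg _)⟩

/-- A real `liminf` takes a default value without such bounds; `|Θ| ≤ 1` excludes this. -/
lemma IsInner.isCoboundedUnder_ge (hΘ : IsInner Θ) (ξ : Circle) :
    IsCoboundedUnder (· ≥ ·) (𝓝[Metric.ball (0 : ℂ) 1] (ξ : ℂ)) fun z => ‖Θ z‖ :=
  IsBoundedUnder.isCoboundedUnder_ge ⟨1, eventually_map.2 (eventually_nhdsWithin_of_forall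
    fun _ hz => hΘ.norm_le_one (mem_ball_zero_iff.1 hz))⟩

lemma IsInner.frequently_lt_of_mem_boundarySpectrum (hΘ : IsInner Θ) {ξ : Circle}
    (hξ : ξ ∈ boundarySpectrum Θ) {ε : ℝ} (hε : 0 < ε) :
    ∃ᶠ z in 𝓝[Metric.ball (0 : ℂ) 1] (ξ : ℂ), ‖Θ z‖ < ε :=
  frequently_lt_of_liminf_lt (hΘ.isCoboundedUnder_ge ξ) (lt_of_eq_of_lt hξ hε)

lemma IsInner.eventually_lt_of_notMem_boundarySpectrum (hΘ : IsInner Θ) {ξ : Circle}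
    (hξ : ξ ∉ boundarySpectrum Θ) :
    ∃ δ > 0, ∀ᶠ z in 𝓝[Metric.ball (0 : ℂ) 1] (ξ : ℂ), δ < ‖Θ z‖ := by
  have h0 : 0 ≤ liminf (fun z : ℂ => ‖Θ z‖) (𝓝[Metric.ball (0 : ℂ) 1] (ξ : ℂ)) :=
    le_liminf_of_le (hΘ.isCoboundedUnder_ge ξ) (.of_forall fun _ => norm_nonneg _)
  obtain ⟨δ, h1, h2⟩ := exists_between (lt_of_le_of_ne h0 (Ne.symm hξ))
  exact ⟨δ, h1, eventually_lt_of_lt_liminf h2 (isBoundedUnder_ge_norm ξ)⟩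

lemma IsInner.infEDist_eq_zero (hΘ : IsInner Θ) {S : Set Circle} (hS : IsDominating Θ S)
    {ζ : Circle} (hζ : ζ ∈ boundarySpectrum Θ) : Metric.infEDist ζ S = 0 := by
  by_contra hne
  -- A finite `d` strictly below the distance also covers empty `S`, where the distance is infinite.
  obtain ⟨d, hd, hdS⟩ : ∃ d : ℝ, 0 < d ∧ ∀ s ∈ S, d ≤ dist ζ s := by
    obtain ⟨d, hd0, hd⟩ := ENNReal.lt_iff_exists_nnreal_btwn.1 (pos_iff_ne_zero.2 hne)
    refine ⟨d, by exact_mod_cast hd0, fun s hs => ?_⟩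
    have h := hd.le.trans (Metric.infEDist_le_edist_of_mem hs)
    rw [edist_dist] at h
    simpa using ENNReal.toReal_mono ENNReal.ofReal_ne_top h
  obtain ⟨C, hC, hdom⟩ := hS.dominates
  have hb : Tendsto (fun z : ℂ => (C * (4 / d) ^ 2) * (1 - ‖z‖ ^ 2))
      (𝓝[Metric.ball (0 : ℂ) 1] (ζ : ℂ)) (𝓝 0) := by
    have : Continuous fun z : ℂ => (C * (4 / d) ^ 2) * (1 - ‖z‖ ^ 2) := by fun_prop
    refine ((this.tendsto (ζ : ℂ)).mono_left nhdsWithin_le_nhds).trans_eq ?_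
    rw [Circle.norm_coe, one_pow, sub_self, mul_zero]
  have hnear : ∀ᶠ z in 𝓝[Metric.ball (0 : ℂ) 1] (ζ : ℂ), dist z (ζ : ℂ) < d / 2 :=
    nhdsWithin_le_nhds (Metric.ball_mem_nhds _ (by positivity))
  -- Domination of the kernel at this `l` will give `1 - |Θ(l)|² ≤ C (4/d)² (1 - |l|²) < 1/2`,
  -- against `|Θ(l)| < 1/2`.
  obtain ⟨l, hl1, hl2, hl3, hl4⟩ := ((hΘ.frequently_lt_of_mem_boundarySpectrum hζ
    (ε := 1 / 2) (by norm_num)).and_eventually ((hb.eventually_lt_const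
      (show (0 : ℝ) < 1 / 2 by norm_num)).and (hnear.and self_mem_nhdsWithin))).exists
  have hl : ‖l‖ < 1 := mem_ball_zero_iff.1 hl4
  have h1 := hdom _ (hΘ.kernel_mem hl)
  have h2 : ∀ᵐ x ∂m.restrict (param S), ‖hΘ.kernel hl x‖ ^ 2 ≤ (4 / d) ^ 2 := by
    filter_upwards [ae_restrict_of_ae (hΘ.coeFn_kernel hl), ae_restrict_of_ae
      hΘ.tendsto_boundaryValue, ae_restrict_mem₀ hS.measurable] with x hx1 hx2 hx3
    rw [hx1]
    gcongr
    have h3 : d / 2 ≤ ‖point x - l‖ := by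
      have h4 : d ≤ dist (ζ : ℂ) (point x) := hdS _ hx3
      have h5 := dist_triangle (ζ : ℂ) l (point x)
      rw [dist_comm] at hl3
      rw [← dist_eq_norm, dist_comm]
      linarith
    have h6 : ‖1 - conj (Θ l) * boundaryValue Θ x‖ ≤ 2 := by
      refine (norm_sub_le _ _).trans ?_
      rw [norm_one, norm_mul, RCLike.norm_conj, hx2.1]
      linarith
    rw [norm_mul, szego, norm_inv, norm_one_sub_mul_point, ← div_eq_mul_inv]
    calc _ ≤ 2 / (d / 2) := by gcongr
      _ = 4 / d := by field_simp; norm_num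
  have h3 : ∫ x in param S, ‖hΘ.kernel hl x‖ ^ 2 ∂m ≤ (4 / d) ^ 2 := by
    refine (integral_mono_ae (integrable_norm_sq _).restrict (integrable_const _) h2).trans ?_
    rw [integral_const, smul_eq_mul]
    refine mul_le_of_le_one_left (by positivity) ?_
    simp
  have h4 := h1.trans (mul_le_mul_of_nonneg_left h3 hC.le)
  rw [hΘ.norm_kernel_sq hl, div_le_iff₀ (one_sub_norm_sq_pos hl)] at h4
  nlinarith [norm_nonneg (Θ l)]

lemma IsInner.dense_of_boundarySpectrum_eq_univ (hΘ : IsInner Θ)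
    (h : boundarySpectrum Θ = Set.univ) {S : Set Circle} (hS : IsDominating Θ S) : Dense S :=
  fun ζ => Metric.mem_closure_iff_infEDist_zero.2 (hΘ.infEDist_eq_zero hS (h ▸ Set.mem_univ ζ))

lemma IsInner.boundarySpectrum_ne_univ (hΘ : IsInner Θ) {S : Set Circle} (hc : IsClosed S)
    (hS : IsDominating Θ S) : boundarySpectrum Θ ≠ Set.univ := by
  intro h
  have hu : S = Set.univ := by
    rw [← hc.closure_eq, (hΘ.dense_of_boundarySpectrum_eq_univ h hS).closure_eq]
  have := hS.measure_lt_one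
  simp [hu, param] at this

end Inner

/-! ### Means of `log |g|` on horizontal segments. -/

lemma hasDerivAt_log_norm {w : ℝ → ℂ} {w' : ℂ} {t : ℝ} (h : HasDerivAt w w' t) (h0 : w t ≠ 0) :
    HasDerivAt (fun s => Real.log ‖w s‖) (w' / w t).re t := by
  have h1 := ((h.norm_sq).log (by simpa using h0)).const_mul (1 / 2 : ℝ)
  refine (h1.congr_deriv ?_).congr_of_eventuallyEq (.of_forall fun s => ?_)
  · rw [Complex.inner, ← Complex.normSq_eq_norm_sq, Complex.div_re]
    simp only [Complex.mul_re, Complex.conj_re, Complex.conj_im]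
    ring
  · simp only [Real.log_pow]
    push_cast
    ring

/-- Differentiation under the integral sign, for a jointly continuous derivative. -/
lemma hasDerivAt_integral_of_continuousOn {a b c : ℝ} (hab : a ≤ b) {F F' : ℝ → ℝ → ℝ}
    (hF' : ContinuousOn (Function.uncurry F') (Set.Ioo 0 c ×ˢ Set.Icc a b))
    (hF : ∀ y ∈ Set.Ioo 0 c, ContinuousOn (F y) (Set.Icc a b))
    (hd : ∀ y ∈ Set.Ioo 0 c, ∀ x ∈ Set.Icc a b, HasDerivAt (fun y => F y x) (F' y x) y)
    {y : ℝ} (hy : y ∈ Set.Ioo 0 c) :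
    HasDerivAt (fun y => ∫ x in a..b, F y x) (∫ x in a..b, F' y x) y := by
  have hs : Set.Icc (y / 2) ((y + c) / 2) ∈ 𝓝 y :=
    Icc_mem_nhds (by linarith [hy.1]) (by linarith [hy.2])
  have hsub : Set.Icc (y / 2) ((y + c) / 2) ⊆ Set.Ioo 0 c := fun t ht =>
    ⟨by linarith [hy.1, ht.1], by linarith [hy.2, ht.2]⟩
  obtain ⟨K, hK⟩ := (isCompact_Icc.prod isCompact_Icc).exists_bound_of_continuousOn
    (hF'.mono (Set.prod_mono hsub subset_rfl))
  have hsubI : Set.uIoc a b ⊆ Set.Icc a b := by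
    rw [Set.uIoc_of_le hab]; exact Set.Ioc_subset_Icc_self
  have hmeas : ∀ {G : ℝ → ℝ}, ContinuousOn G (Set.Icc a b) →
      AEStronglyMeasurable G (volume.restrict (Set.uIoc a b)) := fun hG =>
    (hG.mono hsubI).aestronglyMeasurable measurableSet_uIoc
  refine (intervalIntegral.hasDerivAt_integral_of_dominated_loc_of_deriv_le
    (bound := fun _ => K) hs ?_ ?_ ?_ ?_ intervalIntegrable_const ?_).2
  · filter_upwards [hs] with t ht
    exact hmeas (hF t (hsub ht))
  · exact ContinuousOn.intervalIntegrable (by rw [Set.uIcc_of_le hab]; exact hF y hy)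
  · exact hmeas (hF'.comp (f := fun x => (y, x)) (by fun_prop) fun x hx => ⟨hy, hx⟩)
  · exact .of_forall fun x hx t ht => hK (t, x) ⟨ht, hsubI hx⟩
  · exact .of_forall fun x hx t ht => hd t (hsub ht) x (hsubI hx)

section Strip

variable {g : ℂ → ℂ} {a b c : ℝ}

/-- The point `x + iy`. -/
noncomputable def pt (y x : ℝ) : ℂ := x + y * Complex.I

lemma hasDerivAt_pt_right (y x : ℝ) : HasDerivAt (fun x => pt y x) 1 x := by
  simpa [pt] using ((hasDerivAt_id x).ofReal_comp).add_const (y * Complex.I)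

lemma hasDerivAt_pt_left (y x : ℝ) : HasDerivAt (fun y => pt y x) Complex.I y := by
  simpa [pt] using (((hasDerivAt_id y).ofReal_comp).mul_const Complex.I).const_add (x : ℂ)

lemma continuous_pt : Continuous (Function.uncurry pt) := by
  unfold Function.uncurry pt
  fun_prop

/-- The second derivative in `y` of the weighted mean of the harmonic function `log |g|` on
horizontal segments is bounded: integrate by parts twice. -/
lemma abs_integral_deriv_logDeriv_le {y H : ℝ} (hab : a ≤ b)
    (hg : ∀ x ∈ Set.Icc a b, AnalyticAt ℂ g (pt y x)) (hne : ∀ x ∈ Set.Icc a b, g (pt y x) ≠ 0)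
    (hH : ∀ x ∈ Set.Icc a b, |Real.log ‖g (pt y x)‖| ≤ H) :
    |∫ x in a..b, (x - a) * (b - x) * (deriv (logDeriv g) (pt y x)).re| ≤ 4 * H * (b - a) := by
  have hf : ∀ x ∈ Set.Icc a b, AnalyticAt ℂ (logDeriv g) (pt y x) := fun x hx =>
    (hg x hx).deriv.div (hg x hx) (hne x hx)
  have hpt : Continuous (pt y) := continuous_pt.comp (by fun_prop : Continuous fun x => (y, x))
  have hcont : ∀ {k : ℂ → ℂ}, (∀ x ∈ Set.Icc a b, AnalyticAt ℂ k (pt y x)) →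
      ContinuousOn (fun x => (k (pt y x)).re) (Set.uIcc a b) := fun hk x hx => by
    rw [Set.uIcc_of_le hab] at hx
    exact (Complex.continuous_re.continuousAt.comp ((hk x hx).continuousAt.comp
      hpt.continuousAt)).continuousWithinAt
  have hu : ∀ x ∈ Set.uIcc a b, HasDerivAt (fun x => Real.log ‖g (pt y x)‖)
      (logDeriv g (pt y x)).re x := fun x hx => by
    rw [Set.uIcc_of_le hab] at hx
    refine (hasDerivAt_log_norm ((hg x hx).differentiableAt.hasDerivAt.comp x
      (hasDerivAt_pt_right y x)) (hne x hx)).congr_deriv ?_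
    rw [mul_one, logDeriv_apply, Function.comp_apply]
  have hf' : ∀ x ∈ Set.uIcc a b, HasDerivAt (fun x => (logDeriv g (pt y x)).re)
      (deriv (logDeriv g) (pt y x)).re x := fun x hx => by
    rw [Set.uIcc_of_le hab] at hx
    have := (hf x hx).differentiableAt.hasDerivAt.comp x (hasDerivAt_pt_right y x)
    rw [mul_one] at this
    exact Complex.reCLM.hasFDerivAt.comp_hasDerivAt x this
  have hw : ∀ x ∈ Set.uIcc a b, HasDerivAt (fun x => (x - a) * (b - x)) (a + b - 2 * x) x :=
    fun x _ => by
      refine (((hasDerivAt_id x).sub_const a).mul ((hasDerivAt_id x).const_sub b)).congr_deriv ?_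
      simp only [id]
      ring
  have hw' : ∀ x ∈ Set.uIcc a b, HasDerivAt (fun x => a + b - 2 * x) (-2) x := fun x _ => by
    simpa using ((hasDerivAt_id x).const_mul 2).const_sub (a + b)
  have hw'' : IntervalIntegrable (fun x => a + b - 2 * x) volume a b :=
    (by fun_prop : Continuous fun x => a + b - 2 * x).intervalIntegrable _ _
  -- The weight vanishes at both ends, so no boundary term with `logDeriv g` survives. The second
  -- integration leaves boundary terms and an integral, each at most `2 * H * (b - a)`.
  have e1 := intervalIntegral.integral_mul_deriv_eq_deriv_mul hw hf' hw''
    (hcont fun x hx => (hf x hx).deriv).intervalIntegrable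
  have e2 := intervalIntegral.integral_mul_deriv_eq_deriv_mul hw' hu intervalIntegrable_const
    (hcont hf).intervalIntegrable
  have e3 := intervalIntegral.norm_integral_le_of_norm_le_const (a := a) (b := b)
    (f := fun x => -2 * Real.log ‖g (pt y x)‖) (C := 2 * H) fun x hx => by
      rw [Set.uIoc_of_le hab] at hx
      rw [norm_mul, Real.norm_eq_abs, Real.norm_eq_abs, abs_neg, abs_two]
      exact mul_le_mul_of_nonneg_left (hH x (Set.Ioc_subset_Icc_self hx)) zero_le_two
  rw [Real.norm_eq_abs, abs_of_nonneg (sub_nonneg.2 hab)] at e3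
  rw [e1, e2]
  have ha := abs_le.1 (hH a (Set.left_mem_Icc.2 hab))
  have hb := abs_le.1 (hH b (Set.right_mem_Icc.2 hab))
  have h3 := abs_le.1 e3
  have hba := sub_nonneg.2 hab
  rw [abs_le]
  constructor <;> nlinarith

/-- If `g` is holomorphic and zero-free on a strip `[a, b] × (0, c)`, `log |g|` is bounded there
and tends to zero almost everywhere on `[a, b]`, then the weighted means of `log |g|` on the
horizontal segments at height `y` are `O(y)`. -/
lemma exists_abs_integral_log_norm_le {H : ℝ} (hab : a ≤ b) (hc : 0 < c)
    (hg : ∀ y ∈ Set.Ioo 0 c, ∀ x ∈ Set.Icc a b, AnalyticAt ℂ g (pt y x))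
    (hne : ∀ y ∈ Set.Ioo 0 c, ∀ x ∈ Set.Icc a b, g (pt y x) ≠ 0)
    (hH : ∀ y ∈ Set.Ioo 0 c, ∀ x ∈ Set.Icc a b, |Real.log ‖g (pt y x)‖| ≤ H)
    (hlim : ∀ᵐ x, x ∈ Set.Icc a b →
      Tendsto (fun y => Real.log ‖g (pt y x)‖) (𝓝[>] 0) (𝓝 0)) :
    ∃ K, 0 ≤ K ∧ ∀ y ∈ Set.Ioc 0 (c / 2),
      |∫ x in a..b, (x - a) * (b - x) * Real.log ‖g (pt y x)‖| ≤ K * y := by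
  have hf : ∀ y ∈ Set.Ioo 0 c, ∀ x ∈ Set.Icc a b, AnalyticAt ℂ (logDeriv g) (pt y x) :=
    fun y hy x hx => (hg y hy x hx).deriv.div (hg y hy x hx) (hne y hy x hx)
  have hwc : Continuous fun p : ℝ × ℝ => (p.2 - a) * (b - p.2) := by fun_prop
  have hcont2 : ∀ {k : ℂ → ℝ}, (∀ y ∈ Set.Ioo 0 c, ∀ x ∈ Set.Icc a b, ContinuousAt k (pt y x)) →
      ContinuousOn (Function.uncurry fun y x => (x - a) * (b - x) * k (pt y x))
        (Set.Ioo 0 c ×ˢ Set.Icc a b) := fun {k} hk p hp =>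
    (hwc.continuousAt.mul (ContinuousAt.comp (f := Function.uncurry pt)
      (hk p.1 hp.1 p.2 hp.2) continuous_pt.continuousAt)).continuousWithinAt
  have hcont1 : ∀ {F : ℝ → ℝ → ℝ}, ContinuousOn (Function.uncurry F)
      (Set.Ioo 0 c ×ˢ Set.Icc a b) → ∀ y ∈ Set.Ioo 0 c, ContinuousOn (F y) (Set.Icc a b) :=
    fun hF y hy => hF.comp (f := fun x => (y, x)) (by fun_prop) fun x hx => ⟨hy, hx⟩
  have c0 := hcont2 (k := fun z => Real.log ‖g z‖) fun y hy x hx =>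
    (hg y hy x hx).continuousAt.norm.log (norm_ne_zero_iff.2 (hne y hy x hx))
  have c1 := hcont2 (k := fun z => -(logDeriv g z).im) fun y hy x hx =>
    (Complex.continuous_im.continuousAt.comp (hf y hy x hx).continuousAt).neg
  have c2 := hcont2 (k := fun z => -(deriv (logDeriv g) z).re) fun y hy x hx =>
    (Complex.continuous_re.continuousAt.comp (hf y hy x hx).deriv.continuousAt).neg
  -- With `u = log |g|`, `u_y = -Im (g'/g)` and `u_yy = -Re (g'/g)' = -u_xx`: harmonicity trades the
  -- second `y`-derivative for one in `x`.
  have d1 := fun y (hy : y ∈ Set.Ioo 0 c) => hasDerivAt_integral_of_continuousOn hab c1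
    (hcont1 c0) (fun y hy x hx => by
      have h1 := (hg y hy x hx).differentiableAt.hasDerivAt.comp y (hasDerivAt_pt_left y x)
      refine ((hasDerivAt_log_norm h1 (hne y hy x hx)).const_mul _).congr_deriv ?_
      rw [Function.comp_apply, mul_div_right_comm, ← logDeriv_apply, Complex.mul_I_re]) hy
  have d2 := fun y (hy : y ∈ Set.Ioo 0 c) => hasDerivAt_integral_of_continuousOn hab c2
    (hcont1 c1) (fun y hy x hx => by
      have h1 := (hf y hy x hx).differentiableAt.hasDerivAt.comp y (hasDerivAt_pt_left y x)
      have h2 := Complex.imCLM.hasFDerivAt.comp_hasDerivAt y h1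
      refine (h2.neg.const_mul _).congr_deriv ?_
      rw [Complex.imCLM_apply, Complex.mul_I_im]) hy
  set M := fun y => ∫ x in a..b, (x - a) * (b - x) * Real.log ‖g (pt y x)‖ with hM
  set M1 := fun y => ∫ x in a..b, (x - a) * (b - x) * -(logDeriv g (pt y x)).im with hM1
  have b2 : ∀ y ∈ Set.Ioo 0 c, ‖∫ x in a..b, (x - a) * (b - x) *
      -(deriv (logDeriv g) (pt y x)).re‖ ≤ 4 * H * (b - a) := fun y hy => by
    simp_rw [mul_neg, intervalIntegral.integral_neg]
    rw [norm_neg]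
    exact abs_integral_deriv_logDeriv_le hab (hg y hy) (hne y hy) (hH y hy)
  have hc2 : c / 2 ∈ Set.Ioo 0 c := ⟨by linarith, by linarith⟩
  have hH0 : 0 ≤ H := (abs_nonneg _).trans (hH _ hc2 a (Set.left_mem_Icc.2 hab))
  have hsub : Set.Ioc 0 (c / 2) ⊆ Set.Ioo 0 c := fun y hy => ⟨hy.1, hy.2.trans_lt hc2.2⟩
  have b1 : ∀ y ∈ Set.Ioc 0 (c / 2), ‖M1 y‖ ≤ ‖M1 (c / 2)‖ + 4 * H * (b - a) * c := by
    intro y hy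
    have h := (convex_Ioc 0 (c / 2)).norm_image_sub_le_of_norm_hasDerivWithin_le
      (fun y hy => (d2 y (hsub hy)).hasDerivWithinAt) (fun y hy => b2 y (hsub hy))
      (Set.right_mem_Ioc.2 hc2.1) hy
    have h1 : ‖y - c / 2‖ ≤ c := by
      rw [Real.norm_eq_abs, abs_le]; constructor <;> linarith [hy.1, hy.2]
    have h2 := norm_le_norm_add_norm_sub' (M1 y) (M1 (c / 2))
    have h3 : 4 * H * (b - a) * ‖y - c / 2‖ ≤ 4 * H * (b - a) * c :=
      mul_le_mul_of_nonneg_left h1 (by have := sub_nonneg.2 hab; positivity)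
    linarith
  set K := ‖M1 (c / 2)‖ + 4 * H * (b - a) * c with hK
  have hK0 : 0 ≤ K := by have := sub_nonneg.2 hab; positivity
  refine ⟨K, hK0, fun y hy => ?_⟩
  have lim : Tendsto M (𝓝[>] 0) (𝓝 0) := by
    rw [show 𝓝 (0 : ℝ) = 𝓝 (∫ x in a..b, (0 : ℝ)) by simp]
    refine intervalIntegral.tendsto_integral_filter_of_dominated_convergence
      (fun x => |(x - a) * (b - x)| * H) ?_ ?_ ?_ ?_
    · filter_upwards [Ioo_mem_nhdsGT hc] with t ht
      refine ContinuousOn.aestronglyMeasurable ?_ measurableSet_uIoc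
      refine (hcont1 c0 t ht).mono ?_
      rw [Set.uIoc_of_le hab]; exact Set.Ioc_subset_Icc_self
    · filter_upwards [Ioo_mem_nhdsGT hc] with t ht
      refine .of_forall fun x hx => ?_
      rw [Set.uIoc_of_le hab] at hx
      rw [norm_mul]
      exact mul_le_mul_of_nonneg_left (hH t ht x (Set.Ioc_subset_Icc_self hx)) (norm_nonneg _)
    · exact (by fun_prop : Continuous fun x => |(x - a) * (b - x)| * H).intervalIntegrable _ _
    · filter_upwards [hlim] with x hx hx1
      rw [Set.uIoc_of_le hab] at hx1
      simpa using (hx (Set.Ioc_subset_Icc_self hx1)).const_mul ((x - a) * (b - x))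
  -- The mean value inequality between `t` and `y`, with `t → 0`, avoids any derivative at height
  -- zero.
  have lim2 : Tendsto (fun t => ‖M y - M t‖) (𝓝[>] 0) (𝓝 ‖M y - 0‖) :=
    (tendsto_const_nhds.sub lim).norm
  rw [sub_zero] at lim2
  refine le_of_tendsto lim2 ?_
  filter_upwards [Ioo_mem_nhdsGT hy.1] with t ht
  refine ((convex_Ioc 0 (c / 2)).norm_image_sub_le_of_norm_hasDerivWithin_le
      (fun y hy => (d1 y (hsub hy)).hasDerivWithinAt) b1 ⟨ht.1, ht.2.le.trans hy.2⟩ hy).trans ?_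
  refine mul_le_mul_of_nonneg_left ?_ hK0
  rw [Real.norm_eq_abs, abs_of_pos (by linarith [ht.2])]
  linarith [ht.1]

end Strip

/-! ### Abel means and their `L²` convergence. -/

/-- The Abel mean of the Fourier series of `f`, that is, its Poisson integral. -/
noncomputable def abelMean (r : ℝ) (f : Lp ℂ 2 m) : C(UnitAddCircle, ℂ) :=
  ∑' n : ℤ, ((r : ℂ) ^ n.natAbs * fourierCoeff f n) • fourier n

lemma norm_fourierCoeff_le (f : Lp ℂ 2 m) (n : ℤ) : ‖fourierCoeff f n‖ ≤ ‖f‖ := by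
  rw [← fourierBasis_repr, ← fourierBasis.repr.norm_map]
  exact lp.norm_apply_le_norm two_ne_zero _ n

lemma hasSum_abelMean {r : ℝ} (h0 : 0 ≤ r) (h1 : r < 1) (f : Lp ℂ 2 m) :
    HasSum (fun n : ℤ => ((r : ℂ) ^ n.natAbs * fourierCoeff f n) • fourier (T := 1) n)
      (abelMean r f) := by
  refine Summable.hasSum (Summable.of_norm_bounded (g := fun n : ℤ => r ^ n.natAbs * ‖f‖) ?_ ?_)
  · refine Summable.mul_right _ (Summable.of_nat_of_neg ?_ ?_) <;>
    simpa using summable_geometric_of_lt_one h0 h1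
  · intro n
    rw [norm_smul, norm_mul, norm_pow, Complex.norm_real, Real.norm_of_nonneg h0, fourier_norm,
      mul_one]
    exact mul_le_mul_of_nonneg_left (norm_fourierCoeff_le f n) (by positivity)

lemma abelMean_apply {r : ℝ} (h0 : 0 ≤ r) (h1 : r < 1) {f : Lp ℂ 2 m} (hf : f ∈ H2)
    (x : UnitAddCircle) (hl : ‖(r : ℂ) * point x‖ < 1) :
    abelMean r f x = inner ℂ (szegoLp hl) f := by
  rw [inner_szegoLp hl hf]
  refine (((hasSum_abelMean h0 h1 f).mapL (ContinuousMap.evalCLM ℂ x)).tsum_eq.symm).trans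
    (tsum_congr fun n => ?_)
  simp only [ContinuousMap.evalCLM_apply, ContinuousMap.smul_apply, smul_eq_mul]
  rcases lt_or_ge n 0 with hn | hn
  · rw [hf n hn]; simp
  · lift n to ℕ using hn
    rw [fourier_eq_point, zpow_natCast, Int.natAbs_natCast]
    ring

/-- The Abel mean as an element of `L²`. -/
noncomputable def abelMeanLp (r : ℝ) (f : Lp ℂ 2 m) : Lp ℂ 2 m :=
  ContinuousMap.toLp (E := ℂ) 2 m ℂ (abelMean r f)

lemma fourierCoeff_abelMeanLp {r : ℝ} (h0 : 0 ≤ r) (h1 : r < 1) (f : Lp ℂ 2 m) (k : ℤ) :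
    fourierCoeff (abelMeanLp r f) k = (r : ℂ) ^ k.natAbs * fourierCoeff f k := by
  have h := ((hasSum_abelMean h0 h1 f).mapL (ContinuousMap.toLp (E := ℂ) 2 m ℂ)).mapL
    (innerSL ℂ (fourierLp (T := 1) 2 k))
  rw [← fourierBasis_repr, fourierBasis.repr_apply_apply, coe_fourierBasis]
  refine h.unique ?_
  have h2 : ∀ n : ℤ, innerSL ℂ (fourierLp (T := 1) 2 k) (ContinuousMap.toLp (E := ℂ) 2 m ℂ
      (((r : ℂ) ^ n.natAbs * fourierCoeff f n) • fourier n))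
      = if n = k then (r : ℂ) ^ k.natAbs * fourierCoeff f k else 0 := fun n => by
    have h3 := orthonormal_iff_ite.1 (orthonormal_fourier (T := 1)) k n
    rw [map_smul, innerSL_apply_apply, inner_smul_right]
    refine (congrArg _ h3).trans ?_
    rcases eq_or_ne n k with rfl | hne
    · simp
    · simp [hne, hne.symm]
  simp_rw [h2]
  exact hasSum_ite_eq k _

/-- By Parseval the quantity is the sum of `|1 - r ^ |n||² |f̂(n)|²`, dominated by the sum of
`|f̂(n)|²`. -/
lemma tendsto_abelMeanLp (f : Lp ℂ 2 m) :
    Tendsto (fun r => ‖f - abelMeanLp r f‖ ^ 2) (𝓝[<] 1) (𝓝 0) := by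
  have hev : ∀ᶠ r : ℝ in 𝓝[<] 1, 0 < r ∧ r < 1 := Ioo_mem_nhdsLT one_pos
  have h1 : Tendsto (fun r : ℝ => ∑' n : ℤ, ‖(1 - (r : ℂ) ^ n.natAbs) * fourierCoeff f n‖ ^ 2)
      (𝓝[<] 1) (𝓝 (∑' _ : ℤ, (0 : ℝ))) := by
    refine tendsto_tsum_of_dominated_convergence (bound := fun n => ‖fourierCoeff f n‖ ^ 2)
      (hasSum_sq_fourierCoeff f).summable (fun n => ?_) ?_
    · have : Continuous fun r : ℝ => ‖(1 - (r : ℂ) ^ n.natAbs) * fourierCoeff f n‖ ^ 2 := by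
        fun_prop
      simpa using (this.tendsto 1).mono_left nhdsWithin_le_nhds
    · filter_upwards [hev] with r hr n
      rw [norm_pow, norm_norm, norm_mul]
      have h2 : ‖1 - (r : ℂ) ^ n.natAbs‖ ≤ 1 := by
        have h3 : (1 - (r : ℂ) ^ n.natAbs) = ((1 - r ^ n.natAbs : ℝ) : ℂ) := by push_cast; ring
        rw [h3, Complex.norm_real, Real.norm_of_nonneg]
        · linarith [pow_nonneg hr.1.le n.natAbs]
        · linarith [pow_le_one₀ (n := n.natAbs) hr.1.le hr.2.le]
      gcongr
      exact mul_le_of_le_one_left (norm_nonneg _) h2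
  rw [tsum_zero] at h1
  refine h1.congr' ?_
  filter_upwards [hev] with r hr
  rw [norm_sq_eq_tsum]
  refine tsum_congr fun n => ?_
  rw [← fourierBasis_repr (f - abelMeanLp r f), map_sub, lp.coeFn_sub, Pi.sub_apply,
    fourierBasis_repr, fourierBasis_repr, fourierCoeff_abelMeanLp hr.1.le hr.2, sub_mul, one_mul]

/-! ### Arcs and the pigeonhole argument. -/

/-- The open arc of the points `x mod 1` with `a < x < b`. -/
def arc (a b : ℝ) : Set UnitAddCircle := (fun x : ℝ => (x : UnitAddCircle)) '' Set.Ioo a b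

lemma isOpen_arc (a b : ℝ) : IsOpen (arc a b) :=
  QuotientAddGroup.isOpenMap_coe _ isOpen_Ioo

lemma coe_mem_arc_iff {a b x : ℝ} (hb : b ≤ a + 1) (hx : x ∈ Set.Ioc a (a + 1)) :
    (x : UnitAddCircle) ∈ arc a b ↔ x ∈ Set.Ioo a b := by
  refine ⟨?_, fun h => ⟨x, h, rfl⟩⟩
  rintro ⟨t, ht, hxt⟩
  rwa [← (AddCircle.coe_eq_coe_iff_of_mem_Ioc (p := 1) (a := a)
    ⟨ht.1, ht.2.le.trans hb⟩ hx).1 hxt]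

lemma setIntegral_arc {a b : ℝ} (hab : a ≤ b) (hb : b ≤ a + 1) (F : UnitAddCircle → ℝ) :
    ∫ x in arc a b, F x ∂m = ∫ x in a..b, F x := by
  rw [← integral_indicator (isOpen_arc a b).measurableSet, integral_m_eq _ a,
    intervalIntegral.integral_of_le (by linarith), intervalIntegral.integral_of_le hab]
  have h : ∀ x ∈ Set.Ioc a (a + 1), (arc a b).indicator F (x : UnitAddCircle)
      = (Set.Ioo a b).indicator (fun x : ℝ => F x) x := fun x hx => by
    by_cases hx' : x ∈ Set.Ioo a b
    · rw [Set.indicator_of_mem hx', Set.indicator_of_mem ((coe_mem_arc_iff hb hx).2 hx')]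
    · rw [Set.indicator_of_notMem hx', Set.indicator_of_notMem
        (mt (coe_mem_arc_iff hb hx).1 hx')]
  have hsub : Set.Ioo a b ⊆ Set.Ioc a (a + 1) := fun x hx => ⟨hx.1, hx.2.le.trans hb⟩
  rw [setIntegral_congr_fun measurableSet_Ioc h, setIntegral_indicator measurableSet_Ioo,
    Set.inter_eq_right.2 hsub, integral_Ioc_eq_integral_Ioo]

/-- If the integrals of `ψ y` over `[a, b]` are bounded, there is a subinterval over which the
integral of `ψ y` is small for arbitrarily small `y`. -/
lemma exists_subinterval_frequently_integral_le {ψ : ℝ → ℝ → ℝ} {a b c K ε : ℝ} (hab : a < b)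
    (hc : 0 < c) (hψ : ∀ y ∈ Set.Ioc 0 c, Continuous (ψ y))
    (hK : ∀ y ∈ Set.Ioc 0 c, ∫ x in a..b, ψ y x ≤ K) (hε : 0 < ε) :
    ∃ a' b', a ≤ a' ∧ a' < b' ∧ b' ≤ b ∧ ∃ᶠ y in 𝓝[>] 0, ∫ x in a'..b', ψ y x ≤ ε := by
  obtain ⟨n, hn⟩ := exists_nat_gt (K / ε)
  obtain ⟨N, hN0, hN⟩ : ∃ N : ℕ, 0 < N ∧ K ≤ N * ε := by
    refine ⟨n + 1, n.succ_pos, ?_⟩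
    rw [div_lt_iff₀ hε] at hn
    push_cast
    linarith
  set p : ℕ → ℝ := fun i => a + (b - a) * (i / N) with hp
  have hN' : (0 : ℝ) < N := by exact_mod_cast hN0
  have hba := sub_pos.2 hab
  have key : ∀ y ∈ Set.Ioc 0 c, ∃ i ∈ Finset.range N, ∫ x in p i..p (i + 1), ψ y x ≤ ε := by
    intro y hy
    refine Finset.exists_le_of_sum_le ⟨0, Finset.mem_range.2 hN0⟩ ?_
    rw [intervalIntegral.sum_integral_adjacent_intervals
      fun i _ => (hψ y hy).intervalIntegrable _ _]
    simp only [hp, Nat.cast_zero, zero_div, mul_zero, add_zero, div_self hN'.ne', mul_one,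
      add_sub_cancel, Finset.sum_const, Finset.card_range, nsmul_eq_mul]
    exact (hK y hy).trans hN
  -- The good piece depends on `y`, but there are finitely many: were each eventually bad, all would
  -- be bad at one small `y`.
  obtain ⟨i, hi, hfr⟩ : ∃ i ∈ Finset.range N,
      ∃ᶠ y in 𝓝[>] 0, ∫ x in p i..p (i + 1), ψ y x ≤ ε := by
    by_contra h
    push Not at h
    have h1 : ∀ᶠ y in 𝓝[>] (0 : ℝ), ∀ i ∈ Finset.range N, ¬ ∫ x in p i..p (i + 1), ψ y x ≤ ε :=
      (Filter.eventually_all_finset _).2 fun i hi => (h i hi).mono fun _ => not_le.2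
    obtain ⟨y, hy1, hy2⟩ := (h1.and (Ioc_mem_nhdsGT hc)).exists
    obtain ⟨i, hi, h2⟩ := key y hy2
    exact hy1 i hi h2
  have hi' : (i : ℝ) + 1 ≤ N := by exact_mod_cast Finset.mem_range.1 hi
  refine ⟨p i, p (i + 1), ?_, ?_, ?_, hfr⟩
  · simp only [hp]
    have : 0 ≤ (b - a) * (i / N) := by positivity
    linarith
  · simp only [hp]
    push_cast
    gcongr
    linarith
  · simp only [hp]
    push_cast
    have : (b - a) * ((i + 1) / N) ≤ (b - a) * 1 := by
      gcongr
      rwa [div_le_one hN']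
    linarith

/-! ### A closed dominating set off the boundary spectrum. -/

section Inner

variable {Θ : ℂ → ℂ}

/-- The modulus `e^{-2πy}` of `e^{2πi(x+iy)}`. -/
noncomputable def radius (y : ℝ) : ℝ := Real.exp (-(2 * Real.pi * y))

lemma radius_pos (y : ℝ) : 0 < radius y := Real.exp_pos _

lemma radius_lt_one {y : ℝ} (hy : 0 < y) : radius y < 1 :=
  Real.exp_lt_one_iff.2 (neg_lt_zero.2 (by have := Real.pi_pos; positivity))

lemma tendsto_radius : Tendsto radius (𝓝[>] 0) (𝓝[<] 1) := by
  refine tendsto_nhdsWithin_iff.2 ⟨?_, ?_⟩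
  · have : Continuous radius := by unfold radius; fun_prop
    simpa [radius] using (this.tendsto 0).mono_left nhdsWithin_le_nhds
  · exact eventually_nhdsWithin_of_forall fun y hy => radius_lt_one hy

lemma exp_pt (y x : ℝ) :
    Complex.exp (2 * Real.pi * Complex.I * pt y x) = (radius y : ℂ) * point x := by
  rw [point_coe, radius, Complex.ofReal_exp, ← Complex.exp_add, pt]
  congr 1
  push_cast
  linear_combination 2 * Real.pi * y * Complex.I_mul_I

/-- From `e^{4πy} ≥ 1 + 4πy`. Replacing `1 - r²` by the height `y` lets it cancel the `O(y)` of the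
logarithmic means. -/
lemma le_one_sub_radius_sq {y : ℝ} (h0 : 0 < y) (h1 : y ≤ 1 / 2) : y ≤ 1 - radius y ^ 2 := by
  have h : radius y ^ 2 ≤ (1 + 4 * Real.pi * y)⁻¹ := by
    rw [radius, ← Real.exp_nat_mul, ← inv_inv (Real.exp _), ← Real.exp_neg]
    have := Real.pi_pos
    gcongr
    refine le_trans (le_of_eq ?_) (Real.add_one_le_exp _)
    push_cast
    ring
  have hpi := Real.pi_gt_three
  have h2 : (1 + 4 * Real.pi * y)⁻¹ ≤ 1 - y := by
    have hp : 0 < 1 + 4 * Real.pi * y := by positivity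
    rw [inv_le_iff_one_le_mul₀ hp]
    nlinarith [mul_nonneg h0.le (by linarith : 0 ≤ 1 / 2 - y)]
  linarith

lemma norm_radius_mul_point_lt_one {y : ℝ} (hy : 0 < y) (x : UnitAddCircle) :
    ‖(radius y : ℂ) * point x‖ < 1 :=
  mem_ball_zero_iff.1 (mul_point_mem_ball (radius_pos y).le (radius_lt_one hy) (norm_point x).le)

lemma m_eq_volume : m = (volume : Measure UnitAddCircle) := by
  rw [AddCircle.volume_eq_smul_haarAddCircle, ENNReal.ofReal_one, one_smul]

lemma ae_coe_of_ae {p : UnitAddCircle → Prop} (hp : ∀ᵐ x ∂m, p x) (t : ℝ) :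
    ∀ᵐ x : ℝ, x ∈ Set.Ioc t (t + 1) → p x := by
  rw [m_eq_volume] at hp
  exact (ae_restrict_iff' measurableSet_Ioc).1
    ((UnitAddCircle.measurePreserving_mk t).quasiMeasurePreserving.ae hp)

/-- Off its boundary spectrum, `Θ` is bounded below on a box `[x₀ - η, x₀ + η] × (0, η)`. -/
lemma IsInner.exists_box (hΘ : IsInner Θ) {ξ : Circle} (hξ : ξ ∉ boundarySpectrum Θ) :
    ∃ x₀ η δ : ℝ, 0 < η ∧ η ≤ 1 / 4 ∧ 0 < δ ∧ ∀ y ∈ Set.Ioo 0 η,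
      ∀ x ∈ Set.Icc (x₀ - η) (x₀ + η), δ < ‖Θ ((radius y : ℂ) * point x)‖ := by
  obtain ⟨δ, hδ, hev⟩ := hΘ.eventually_lt_of_notMem_boundarySpectrum hξ
  obtain ⟨ε, hε, hsub⟩ := Metric.mem_nhdsWithin_iff.1 hev
  obtain ⟨x₀', hx₀'⟩ : ∃ x : UnitAddCircle, AddCircle.toCircle x = ξ :=
    ⟨(AddCircle.homeomorphCircle one_ne_zero).symm ξ, by
      rw [← AddCircle.homeomorphCircle_apply one_ne_zero, Homeomorph.apply_symm_apply]⟩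
  obtain ⟨x₀, rfl⟩ := QuotientAddGroup.mk_surjective x₀'
  have hE : Continuous fun p : ℝ × ℝ => (radius p.1 : ℂ) * point p.2 := by
    simp_rw [← exp_pt]
    exact Complex.continuous_exp.comp (continuous_const.mul continuous_pt)
  have hE0 : (radius 0 : ℂ) * point (x₀ : UnitAddCircle) = ξ := by
    rw [radius, mul_zero, neg_zero, Real.exp_zero, Complex.ofReal_one, one_mul, point, ← hx₀']
  obtain ⟨ρ, hρ, hball⟩ := Metric.continuousAt_iff.1 (hE.continuousAt (x := (0, x₀))) ε hε
  refine ⟨x₀, min (ρ / 2) (1 / 4), δ, by positivity, min_le_right _ _, hδ, fun y hy x hx => ?_⟩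
  refine hsub ⟨?_, mem_ball_zero_iff.2 (norm_radius_mul_point_lt_one hy.1 x)⟩
  have h1 : dist (y, x) ((0 : ℝ), x₀) < ρ := by
    have hm := min_le_left (ρ / 2) (1 / 4)
    rw [Prod.dist_eq, max_lt_iff, Real.dist_eq, Real.dist_eq, abs_lt, abs_lt]
    refine ⟨⟨?_, ?_⟩, ?_, ?_⟩ <;> linarith [hy.1, hy.2, hx.1, hx.2]
  have := hball h1
  rwa [hE0] at this

/-- Off the boundary spectrum, `(1 - |Θ|²) / (1 - r²)` has bounded means over a fixed arc. -/
lemma IsInner.exists_integral_le (hΘ : IsInner Θ) {ξ : Circle} (hξ : ξ ∉ boundarySpectrum Θ) :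
    ∃ a b c K : ℝ, a < b ∧ b ≤ a + 1 / 2 ∧ 0 < c ∧ ∀ y ∈ Set.Ioc 0 c, ∫ x in a..b,
      (1 - ‖Θ ((radius y : ℂ) * point x)‖ ^ 2) / (1 - ‖(radius y : ℂ) * point x‖ ^ 2) ≤ K := by
  obtain ⟨x₀, η, δ, hη, hη4, hδ, hbox⟩ := hΘ.exists_box hξ
  set e : ℂ → ℂ := fun z => Complex.exp (2 * Real.pi * Complex.I * z) with he
  have hge : ∀ y x : ℝ, (Θ ∘ e) (pt y x) = Θ ((radius y : ℂ) * point x) := fun y x =>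
    congrArg Θ (exp_pt y x)
  have hab : x₀ - η ≤ x₀ + η := by linarith
  have hle1 : ∀ y ∈ Set.Ioo 0 η, ∀ x : ℝ, ‖Θ ((radius y : ℂ) * point x)‖ ≤ 1 := fun y hy x =>
    hΘ.norm_le_one (norm_radius_mul_point_lt_one hy.1 x)
  have han : ∀ y ∈ Set.Ioo 0 η, ∀ x ∈ Set.Icc (x₀ - η) (x₀ + η),
      AnalyticAt ℂ (Θ ∘ e) (pt y x) := by
    intro y hy x _
    have h1 : AnalyticAt ℂ Θ (e (pt y x)) :=
      hΘ.holomorphic.analyticAt (Metric.isOpen_ball.mem_nhds (by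
        rw [he]; simp only []; rw [exp_pt]
        exact mem_ball_zero_iff.2 (norm_radius_mul_point_lt_one hy.1 x)))
    have h2 : AnalyticAt ℂ e (pt y x) :=
      (by fun_prop : Differentiable ℂ e).analyticAt _
    exact h1.comp h2
  have hne : ∀ y ∈ Set.Ioo 0 η, ∀ x ∈ Set.Icc (x₀ - η) (x₀ + η), (Θ ∘ e) (pt y x) ≠ 0 :=
    fun y hy x hx h => by
      have := hbox y hy x hx
      rw [← hge, h, norm_zero] at this
      exact this.not_gt hδ
  have hH : ∀ y ∈ Set.Ioo 0 η, ∀ x ∈ Set.Icc (x₀ - η) (x₀ + η),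
      |Real.log ‖(Θ ∘ e) (pt y x)‖| ≤ -Real.log δ := fun y hy x hx => by
    have h1 := hbox y hy x hx
    rw [hge, abs_of_nonpos (Real.log_nonpos (norm_nonneg _) (hle1 y hy x))]
    exact neg_le_neg (Real.log_le_log hδ h1.le)
  have hlim : ∀ᵐ x : ℝ, x ∈ Set.Icc (x₀ - η) (x₀ + η) →
      Tendsto (fun y => Real.log ‖(Θ ∘ e) (pt y x)‖) (𝓝[>] 0) (𝓝 0) := by
    filter_upwards [ae_coe_of_ae hΘ.tendsto_boundaryValue (x₀ - 1 / 2)] with x hx hx1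
    obtain ⟨h1, h2⟩ := hx ⟨by linarith [hx1.1], by linarith [hx1.2]⟩
    have h3 := (h2.comp tendsto_radius).norm.log (by rw [h1]; exact one_ne_zero)
    rw [h1, Real.log_one] at h3
    simpa only [hge, Function.comp_apply] using h3
  obtain ⟨K, hK0, hK⟩ := exists_abs_integral_log_norm_le hab hη han hne hH hlim
  -- On the middle half the weight `η² - (x - x₀)²` is at least `3η²/4`; the factor `2 * K` is `(2 /
  -- y) * (K * y)`.
  refine ⟨x₀ - η / 2, x₀ + η / 2, η / 2, 4 / (3 * η ^ 2) * (2 * K), by linarith, by linarith,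
    by linarith, fun y hy => ?_⟩
  have hy' : y ∈ Set.Ioo 0 η := ⟨hy.1, hy.2.trans_lt (by linarith)⟩
  have hM := hK y hy
  set L : ℝ → ℝ := fun x => Real.log ‖(Θ ∘ e) (pt y x)‖ with hL
  set ψ : ℝ → ℝ := fun x =>
    (1 - ‖Θ ((radius y : ℂ) * point x)‖ ^ 2) / (1 - ‖(radius y : ℂ) * point x‖ ^ 2) with hψ
  have hden : ∀ x : ℝ, 1 - ‖(radius y : ℂ) * point x‖ ^ 2 = 1 - radius y ^ 2 := fun x => by
    rw [norm_mul, norm_point, mul_one, Complex.norm_real, Real.norm_of_nonneg (radius_pos y).le]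
  have hyr := le_one_sub_radius_sq hy.1 (by linarith [hy'.2])
  have hΘc : Continuous fun x : ℝ => Θ ((radius y : ℂ) * point x) :=
    (hΘ.continuous_dilate (radius_pos y).le (radius_lt_one hy.1)).comp
      (AddCircle.continuous_mk' 1)
  have hψc : Continuous ψ := by
    simp only [hψ, hden]
    exact (continuous_const.sub (hΘc.norm.pow 2)).div_const _
  have hψ0 : ∀ x, 0 ≤ ψ x := fun x => by
    refine div_nonneg ?_ (by rw [hden]; linarith [hy.1])
    have := hle1 y hy' x
    nlinarith [norm_nonneg (Θ ((radius y : ℂ) * point x))]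
  -- Uses `log s ≤ s - 1` at `s = |Θ|²`.
  have hψL : ∀ x ∈ Set.Icc (x₀ - η) (x₀ + η), ψ x ≤ (2 / y) * -L x := fun x hx => by
    have h1 := hbox y hy' x hx
    have h2 := Real.log_le_sub_one_of_pos (show 0 < ‖Θ ((radius y : ℂ) * point x)‖ ^ 2 by
      have := hδ.trans h1; positivity)
    rw [Real.log_pow] at h2
    push_cast at h2
    have h3 : 0 ≤ 1 - ‖Θ ((radius y : ℂ) * point x)‖ ^ 2 := by
      have := hle1 y hy' x
      nlinarith [norm_nonneg (Θ ((radius y : ℂ) * point x))]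
    calc ψ x ≤ (1 - ‖Θ ((radius y : ℂ) * point x)‖ ^ 2) / y := by
          simp only [hψ, hden]
          exact div_le_div_of_nonneg_left h3 hy.1 hyr
      _ ≤ (2 * -L x) / y := by
          refine div_le_div_of_nonneg_right ?_ hy.1.le
          simp only [hL, hge]
          linarith
      _ = (2 / y) * -L x := by ring
  have hLc : ContinuousOn L (Set.uIcc (x₀ - η) (x₀ + η)) := by
    rw [Set.uIcc_of_le hab]
    intro x hx
    simp only [hL, hge]
    refine (hΘc.norm.continuousAt.log ?_).continuousWithinAt
    rw [← hge]
    exact norm_ne_zero_iff.2 (hne y hy' x hx)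
  have hw : Continuous fun x : ℝ => (x - (x₀ - η)) * (x₀ + η - x) := by fun_prop
  calc ∫ x in (x₀ - η / 2)..(x₀ + η / 2), ψ x
      ≤ ∫ x in (x₀ - η / 2)..(x₀ + η / 2),
        4 / (3 * η ^ 2) * ((x - (x₀ - η)) * (x₀ + η - x) * ψ x) := by
        refine intervalIntegral.integral_mono_on (by linarith) (hψc.intervalIntegrable _ _)
          ((continuous_const.mul (hw.mul hψc)).intervalIntegrable _ _) fun x hx => ?_
        rw [← mul_assoc]
        refine le_mul_of_one_le_left (hψ0 x) ?_
        rw [div_mul_eq_mul_div, le_div_iff₀ (by positivity)]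
        nlinarith [mul_nonneg (sub_nonneg.2 hx.1) (sub_nonneg.2 hx.2)]
    _ = 4 / (3 * η ^ 2) * ∫ x in (x₀ - η / 2)..(x₀ + η / 2),
        (x - (x₀ - η)) * (x₀ + η - x) * ψ x := by rw [intervalIntegral.integral_const_mul]
    _ ≤ 4 / (3 * η ^ 2) * ∫ x in (x₀ - η)..(x₀ + η),
        (x - (x₀ - η)) * (x₀ + η - x) * ψ x := by
        refine mul_le_mul_of_nonneg_left ?_ (by positivity)
        refine intervalIntegral.integral_mono_interval (by linarith) (by linarith) (by linarith)
          ?_ ((hw.mul hψc).intervalIntegrable _ _)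
        refine (ae_restrict_iff' measurableSet_Ioc).2 (.of_forall fun x hx => ?_)
        exact mul_nonneg (mul_nonneg (by linarith [hx.1]) (by linarith [hx.2])) (hψ0 x)
    _ ≤ 4 / (3 * η ^ 2) * ∫ x in (x₀ - η)..(x₀ + η),
        (-(2 / y)) * ((x - (x₀ - η)) * (x₀ + η - x) * L x) := by
        refine mul_le_mul_of_nonneg_left ?_ (by positivity)
        refine intervalIntegral.integral_mono_on hab ((hw.mul hψc).intervalIntegrable _ _)
          (continuousOn_const.mul (hw.continuousOn.mul hLc)).intervalIntegrable fun x hx => ?_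
        have := mul_le_mul_of_nonneg_left (hψL x hx)
          (mul_nonneg (sub_nonneg.2 hx.1) (sub_nonneg.2 hx.2))
        linarith
    _ = 4 / (3 * η ^ 2) * ((-(2 / y)) * ∫ x in (x₀ - η)..(x₀ + η),
        (x - (x₀ - η)) * (x₀ + η - x) * L x) := by rw [intervalIntegral.integral_const_mul]
    _ ≤ 4 / (3 * η ^ 2) * (2 * K) := by
        refine mul_le_mul_of_nonneg_left ?_ (by positivity)
        have h1 := (abs_le.1 hM).1
        have h2 : 0 < 2 / y := div_pos two_pos hy.1
        have h3 : 2 / y * (K * y) = 2 * K := by have := hy.1.ne'; field_simp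
        nlinarith

lemma integral_norm_sq_add_compl {J : Set UnitAddCircle} (hJ : MeasurableSet J) (f : Lp ℂ 2 m) :
    ‖f‖ ^ 2 = ∫ x in J, ‖f x‖ ^ 2 ∂m + ∫ x in Jᶜ, ‖f x‖ ^ 2 ∂m := by
  rw [norm_sq_eq_integral, integral_add_compl hJ (integrable_norm_sq f)]

lemma setIntegral_norm_sq_le {J : Set UnitAddCircle} (f g : Lp ℂ 2 m) :
    ∫ x in J, ‖f x‖ ^ 2 ∂m ≤ 2 * ∫ x in J, ‖g x‖ ^ 2 ∂m + 2 * ‖f - g‖ ^ 2 := by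
  have h1 : ∫ x in J, ‖f x‖ ^ 2 ∂m ≤
      ∫ x in J, (2 * ‖g x‖ ^ 2 + 2 * ‖(f - g : Lp ℂ 2 m) x‖ ^ 2) ∂m := by
    refine integral_mono_ae (integrable_norm_sq f).restrict
      (((integrable_norm_sq g).const_mul 2).add
        ((integrable_norm_sq (f - g)).const_mul 2)).restrict ?_
    filter_upwards [ae_restrict_of_ae (Lp.coeFn_sub f g)] with x hx
    rw [hx, Pi.sub_apply]
    have h2 := norm_le_norm_add_norm_sub (g x) (f x)
    rw [norm_sub_rev] at h2
    nlinarith [norm_nonneg (f x), norm_nonneg (g x), norm_nonneg (f x - g x),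
      sq_nonneg (‖g x‖ - ‖f x - g x‖)]
  rw [integral_add ((integrable_norm_sq g).const_mul 2).restrict
    ((integrable_norm_sq (f - g)).const_mul 2).restrict, integral_const_mul,
    integral_const_mul] at h1
  have h3 : ∫ x in J, ‖(f - g : Lp ℂ 2 m) x‖ ^ 2 ∂m ≤ ‖f - g‖ ^ 2 := by
    rw [norm_sq_eq_integral]
    exact setIntegral_le_integral (integrable_norm_sq _) (.of_forall fun x => sq_nonneg _)
  linarith

/-- Off the boundary spectrum there is an arc carrying at most half the mass of every function
in the model space. -/
lemma IsInner.exists_arc (hΘ : IsInner Θ) {ξ : Circle} (hξ : ξ ∉ boundarySpectrum Θ) :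
    ∃ a b : ℝ, a < b ∧ ∀ f ∈ modelSpace Θ, ∫ x in arc a b, ‖f x‖ ^ 2 ∂m ≤ 1 / 2 * ‖f‖ ^ 2 := by
  obtain ⟨a₀, b₀, c, K, hab₀, hb₀, hc, hK⟩ := hΘ.exists_integral_le hξ
  set ψ : ℝ → UnitAddCircle → ℝ := fun y x =>
    (1 - ‖Θ ((radius y : ℂ) * point x)‖ ^ 2) / (1 - ‖(radius y : ℂ) * point x‖ ^ 2) with hψ
  have hψc : ∀ y, 0 < y → Continuous (ψ y) := fun y hy =>
    (continuous_const.sub ((hΘ.continuous_dilate (radius_pos y).le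
      (radius_lt_one hy)).norm.pow 2)).div (continuous_const.sub
        ((continuous_const.mul continuous_point).norm.pow 2))
      fun x => (one_sub_norm_sq_pos (norm_radius_mul_point_lt_one hy x)).ne'
  -- The choice `1 / 4` becomes `1 / 2` after the factor `2` lost in comparing `f` with its Abel
  -- mean.
  obtain ⟨a, b, ha, hab, hb, hfr⟩ := exists_subinterval_frequently_integral_le
    (ψ := fun y x => ψ y x) (ε := 1 / 4) hab₀ hc
    (fun y hy => (hψc y hy.1).comp (AddCircle.continuous_mk' 1)) hK (by norm_num)
  refine ⟨a, b, hab, fun f hf => ?_⟩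
  have hlim : Tendsto (fun y => 1 / 2 * ‖f‖ ^ 2 + 2 * ‖f - abelMeanLp (radius y) f‖ ^ 2)
      (𝓝[>] 0) (𝓝 (1 / 2 * ‖f‖ ^ 2)) := by
    simpa using (((tendsto_abelMeanLp f).comp tendsto_radius).const_mul 2).const_add
      (1 / 2 * ‖f‖ ^ 2)
  refine ge_of_tendsto_of_frequently hlim ?_
  refine (hfr.and_eventually self_mem_nhdsWithin).mono fun y ⟨hy, hy0⟩ => ?_
  have hy0 : 0 < y := hy0
  refine (setIntegral_norm_sq_le f (abelMeanLp (radius y) f)).trans ?_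
  have h1 : ∫ x in arc a b, ‖abelMeanLp (radius y) f x‖ ^ 2 ∂m
      ≤ ∫ x in arc a b, ‖f‖ ^ 2 * ψ y x ∂m := by
    refine integral_mono_ae (integrable_norm_sq _).restrict
      ((continuous_const.mul (hψc y hy0)).integrable_of_hasCompactSupport
        (HasCompactSupport.of_compactSpace _)).restrict ?_
    filter_upwards [ae_restrict_of_ae (ContinuousMap.coeFn_toLp (p := 2) (𝕜 := ℂ) m
      (abelMean (radius y) f))] with x hx
    rw [abelMeanLp, hx, abelMean_apply (radius_pos y).le (radius_lt_one hy0) hf.1 x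
      (norm_radius_mul_point_lt_one hy0 x)]
    exact hΘ.norm_inner_szegoLp_sq_le _ hf
  rw [integral_const_mul, setIntegral_arc hab.le (by linarith) (ψ y)] at h1
  nlinarith [mul_le_mul_of_nonneg_left hy (sq_nonneg ‖f‖)]

lemma IsInner.exists_isClosed_isDominating (hΘ : IsInner Θ)
    (h : boundarySpectrum Θ ≠ Set.univ) : ∃ S : Set Circle, IsClosed S ∧ IsDominating Θ S := by
  obtain ⟨ξ, hξ⟩ := (Set.ne_univ_iff_exists_notMem _).1 h
  obtain ⟨a, b, hab, harc⟩ := hΘ.exists_arc hξ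
  set φ := AddCircle.homeomorphCircle (T := 1) one_ne_zero with hφ
  have hparam : param (φ '' arc a b)ᶜ = (arc a b)ᶜ := by
    ext x
    rw [param, Set.preimage_compl, Set.mem_compl_iff, Set.mem_preimage,
      ← AddCircle.homeomorphCircle_apply one_ne_zero, φ.injective.mem_set_image,
      Set.mem_compl_iff]
  have hmeas := (isOpen_arc a b).measurableSet
  have hpos : 0 < m (arc a b) :=
    (isOpen_arc a b).measure_pos m ((Set.nonempty_Ioo.2 hab).image _)
  -- At least half the mass lies off the arc, whence the constant `2`.
  refine ⟨(φ '' arc a b)ᶜ, (φ.isOpenMap _ (isOpen_arc a b)).isClosed_compl, ?_, ?_, 2, two_pos,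
    fun f hf => ?_⟩
  · rw [hparam]; exact hmeas.compl.nullMeasurableSet
  · rw [hparam, prob_compl_eq_one_sub hmeas]
    exact ENNReal.sub_lt_self ENNReal.one_ne_top one_ne_zero hpos.ne'
  · rw [hparam]
    have h1 := integral_norm_sq_add_compl hmeas f
    have h2 := harc f hf
    linarith

end Inner

end ModelSpace

theorem mainTheorem8 (Θ : ℂ → ℂ) (hΘ : ModelSpace.IsInner Θ) :
    (∀ S : Set Circle, ModelSpace.IsDominating Θ S →
      ∀ ζ ∈ ModelSpace.boundarySpectrum Θ, Metric.infEDist ζ S = 0) ∧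
    (ModelSpace.boundarySpectrum Θ = Set.univ →
      ∀ S : Set Circle, ModelSpace.IsDominating Θ S → Dense S) ∧
    ((∃ S : Set Circle, IsClosed S ∧ ModelSpace.IsDominating Θ S) ↔
      ModelSpace.boundarySpectrum Θ ≠ Set.univ) :=
  ⟨fun _ hS _ hζ => hΘ.infEDist_eq_zero hS hζ,
    fun h _ hS => hΘ.dense_of_boundarySpectrum_eq_univ h hS,
    fun ⟨_, hc, hS⟩ => hΘ.boundarySpectrum_ne_univ hc hS, hΘ.exists_isClosed_isDominating⟩
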